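/- **Theorem C.** Let $\mathcal L$ be a functional first-order language (operation and constant symbols, no predicate symbols other than equality); an $\mathcal L$-structure with nonempty universe is called an algebra. Let $\mathcal A$ be an equationally Noetherian algebra, i.e. for every positive integer $n$ each system $S$ of equations $t=s$ between $\mathcal L$-terms in $x_1,\dots,x_n$ has a finite subsystem $S_0\subseteq S$ with the same set of solutions in $A^n$. Let $\mathcal C$ be a finitely generated algebra. Then the following conditions are equivalent: 1. $\mathcal C\in\mathbf{Qvar}(\mathcal A)$, the class of all models of $\mathrm{Th}_{\rm qi}(\mathcal A)$; equivalently, $\mathrm{Th}_{\rm qi}(\mathcal A)\subseteq\mathrm{Th}_{\rm qi}(\mathcal C)$. Here $\mathrm{Th}_{\rm qi}(\mathcal B)$ is the set of all quasi-identities $\forall x_1\dots\forall x_n\,(\bigwedge_{i=1}^m t_i=s_i\to t=s)$ true in $\mathcal B$. 2. $\mathcal C\in\mathbf{Pvar}(\mathcal A)$, the least class of algebras that contains $\mathcal A$ and is closed under isomorphisms, subalgebras and direct products (the product of the empty family is the trivial one-element algebra). 3. $\mathcal C$ embeds into a direct power $\mathcal A^I$ of $\mathcal A$ (the index set $I$ may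 be empty). 4. $\mathcal C$ is separated by $\mathcal A$: for any $c_1\neq c_2$ in $\mathcal C$ there is a homomorphism $h\colon\mathcal C\to\mathcal A$ with $h(c_1)\ne h(c_2)$. 5. $\mathcal C$ is a subdirect product of finitely many (possibly zero) limit algebras over $\mathcal A$, i.e. $\mathcal C$ embeds into a finite direct product of limit algebras over $\mathcal A$ so that each projection to a factor is surjective on $\mathcal C$. 6. $\mathcal C$ is defined by a complete atomic type in the theory $T=\mathrm{Th}_{\rm qi}(\mathcal A)$: for some $n$ there is a maximal set $p$ of atomic formulas and negated atomic formulas in $x_1,\dots,x_n$ that is consistent with $T$ (all formulas of $p$ hold simultaneously at some tuple of some model of $T$), such that $\mathcal C$ is isomorphic to the quotient of the algebra of terms in $x_1,\dots,x_n$ by the congruence $\{(t,s) : (t=s)\in p\}$. 7. $\mathcal C$ is the coordinate algebra of an algebraic set over $\mathcal A$: for some $n$ and some solution set $Y\subseteq A^n$ of a system of equations of $\mathcal L$, $\mathcal C$ is isomorphic to the quotient of the algebra of terms in $x_1,\dots,x_n$ by the congruence of all pairs $(t,s)$ such that $t=s$ holds at every point of $Y$. Limit algebras are defined as follows. A *diagram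 formula* in a finite set $X$ of variables is a consistent conjunction of all inequations $a\ne b$ for distinct $a,b\in X$ and of finitely many formulas $F(a_1,\dots,a_n)=b$ with $F$ an operation symbol of $\mathcal L$ (of arity $n\ge 0$) and $a_1,\dots,a_n,b\in X$. A *direct system of diagram formulas* consists of a nonempty directed partially ordered set $I$, diagram formulas $\varphi_i$ in finite sets of variables $X_i$ $(i\in I)$, and a direct system of maps $\gamma_{ij}\colon X_i\to X_j$ $(i\le j)$ carrying each conjunct of $\varphi_i$ to a conjunct of $\varphi_j$, such that for all $i\in I$, all operation symbols $F$ and all $a_1,\dots,a_n\in X_i$ there are $j\ge i$ and $b\in X_j$ for which $F(\gamma_{ij}(a_1),\dots,\gamma_{ij}(a_n))=b$ is a conjunct of $\varphi_j$. Its limit is the algebra with universe $\varinjlim X_i$ in which $F$ is evaluated according to the conjuncts $F(a_1,\dots,a_n)=b$ of the $\varphi_i$. A *limit algebra over $\mathcal A$* is an algebra isomorphic to the limit of a direct system of diagram formulas each of which is satisfied in $\mathcal A$ by some assignment of its variables. -/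

import Mathlib

universe u v w

namespace UAG

open FirstOrder FirstOrder.Language FirstOrder.Language.Structure

noncomputable section

/-! ### Basic constructions of algebras -/

section Constructions

variable {L : FirstOrder.Language.{u, v}}

/-- The direct product of a family of structures (operations and relations are pointwise). -/
instance piStructure {I : Type*} (M : I → Type*) [∀ i, L.Structure (M i)] :
    L.Structure (∀ i, M i) where
  funMap f x := fun i => funMap f fun k => x k i
  RelMap r x := ∀ i, RelMap r fun k => x k i

/-- The absolutely free algebra of terms with variables in `α`. -/
instance termAlgebra [L.IsAlgebraic] (α : Type*) : L.Structure (L.Term α) where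
  funMap f ts := Term.func f ts
  RelMap {n} r _ := isEmptyElim r

/-- A congruence on an algebra: an equivalence relation compatible with all operations. -/
structure Congruence (L : FirstOrder.Language.{u, v}) (M : Type*) [L.Structure M] extends Setoid M where
  map_fun : ∀ {n : ℕ} (f : L.Functions n) (x y : Fin n → M),
    (∀ i, r (x i) (y i)) → r (funMap f x) (funMap f y)

variable [L.IsAlgebraic] {M : Type*} [L.Structure M]

instance Congruence.prestructure (θ : Congruence L M) : L.Prestructure θ.toSetoid where
  toStructure := inferInstance
  fun_equiv {_} {f} x y h := θ.map_fun f x y h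
  rel_equiv {_} {r} _ _ _ := isEmptyElim r

/-- The quotient algebra `M / θ`. -/
def Congruence.Quot (θ : Congruence L M) : Type _ := Quotient θ.toSetoid

instance Congruence.quotStructure (θ : Congruence L M) : L.Structure θ.Quot :=
  inferInstanceAs (L.Structure (Quotient θ.toSetoid))

end Constructions

/-! ### Equations, algebraic sets, coordinate algebras -/

section Equations

variable (L : FirstOrder.Language.{u, v})

/-- An equation `t = s` in the variables `x₁, …, xₙ`, recorded as the pair `(t, s)`. -/
abbrev Equation (n : ℕ) : Type u := L.Term (Fin n) × L.Term (Fin n)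

variable {L} (A : Type w) [L.Structure A] {n : ℕ}

/-- The algebraic set `V_A(S) ⊆ Aⁿ` of all common roots of the system `S`. -/
def zeroSet (S : Set (Equation L n)) : Set (Fin n → A) :=
  {p | ∀ e ∈ S, e.1.realize p = e.2.realize p}

variable (L) in
/-- `A` is equationally Noetherian (with respect to equations of `L`). -/
def IsEquationallyNoetherian : Prop :=
  ∀ n : ℕ, 0 < n → ∀ S : Set (Equation L n),
    ∃ S₀ : Set (Equation L n), S₀ ⊆ S ∧ S₀.Finite ∧ zeroSet A S = zeroSet A S₀

variable {A}

variable (L) in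
/-- `Y ⊆ Aⁿ` is an algebraic set over `A`. -/
def IsAlgebraicSet (Y : Set (Fin n → A)) : Prop :=
  ∃ S : Set (Equation L n), Y = zeroSet A S

variable (L) in
/-- The radical of `Y`: all equations that hold at every point of `Y`. -/
def radical (Y : Set (Fin n → A)) : Set (Equation L n) :=
  {e | ∀ p ∈ Y, e.1.realize p = e.2.realize p}

variable (L) in
/-- The congruence on the term algebra given by the radical of `Y`. -/
def radicalCongruence [L.IsAlgebraic] (Y : Set (Fin n → A)) :
    Congruence L (L.Term (Fin n)) where
  r t s := (t, s) ∈ radical L Y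
  iseqv := ⟨fun _ _ _ => rfl, fun h p hp => (h p hp).symm,
    fun h h' p hp => (h p hp).trans (h' p hp)⟩
  map_fun f _ _ h p hp := congrArg (funMap f) (funext fun i => h i p hp)

variable (L) in
/-- The coordinate algebra `Γ(Y)`. -/
abbrev CoordinateAlgebra [L.IsAlgebraic] (Y : Set (Fin n → A)) : Type u :=
  (radicalCongruence L Y).Quot

variable (L) in
/-- `C` is (isomorphic to) the coordinate algebra of an algebraic set over `A`. -/
def IsCoordinateAlgebra [L.IsAlgebraic] (A C : Type w) [L.Structure A] [L.Structure C] : Prop :=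
  ∃ (n : ℕ) (Y : Set (Fin n → A)), IsAlgebraicSet L Y ∧ Nonempty (C ≃[L] CoordinateAlgebra L Y)

end Equations

/-! ### Quasi-identities, quasivarieties, prevarieties, separation -/

section Classes

variable (L : FirstOrder.Language.{u, v})

/-- The sentence `∀ x₁ … xₙ (⋀ (tᵢ = sᵢ) → t = s)`, where the pairs `(tᵢ, sᵢ)` run over the
finite list `E` and `(t, s) = e`. -/
def quasiIdentity {L : FirstOrder.Language.{u, v}} {n : ℕ}
    (E : List (L.Term (Empty ⊕ Fin n) × L.Term (Empty ⊕ Fin n)))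
    (e : L.Term (Empty ⊕ Fin n) × L.Term (Empty ⊕ Fin n)) : L.Sentence :=
  BoundedFormula.alls
    (((E.map fun d => Term.bdEqual d.1 d.2).foldr (· ⊓ ·) ⊤).imp (Term.bdEqual e.1 e.2))

/-- `Th_qi(A)`: the set of all quasi-identities true in `A`. -/
def quasiTheory (A : Type w) [L.Structure A] : L.Theory :=
  {φ | (∃ (n : ℕ) (E : List (L.Term (Empty ⊕ Fin n) × L.Term (Empty ⊕ Fin n)))
      (e : L.Term (Empty ⊕ Fin n) × L.Term (Empty ⊕ Fin n)), φ = quasiIdentity E e) ∧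
    φ.Realize A}

/-- `C ∈ Qvar(A) = Mod(Th_qi(A))`. -/
def InQvar (A C : Type w) [L.Structure A] [L.Structure C] : Prop :=
  (quasiTheory L A).Model C

/-- A prevariety: a class of algebras closed under isomorphisms, (nonempty) subalgebras and
direct products (the product of the empty family being the trivial algebra). -/
structure IsPrevariety (K : (M : Type w) → [L.Structure M] → Prop) : Prop where
  iso : ∀ (M N : Type w) [L.Structure M] [L.Structure N], (M ≃[L] N) → K M → K N
  sub : ∀ (M : Type w) [L.Structure M] (S : L.Substructure M),
    (S : Set M).Nonempty → K M → K S
  prod : ∀ (I : Type w) (M : I → Type w) [∀ i, L.Structure (M i)],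
    (∀ i, K (M i)) → K (∀ i, M i)

/-- `C ∈ Pvar(A)`: `C` lies in the least prevariety containing `A`. -/
def InPvar (A C : Type w) [L.Structure A] [L.Structure C] : Prop :=
  ∀ K : (M : Type w) → [L.Structure M] → Prop, IsPrevariety L K → K A → K C

/-- `C` embeds into a direct power of `A`. -/
def EmbedsInPower (A C : Type w) [L.Structure A] [L.Structure C] : Prop :=
  ∃ I : Type w, Nonempty (C ↪[L] (I → A))

/-- `C` is separated by `A`. -/
def IsSeparatedBy (A C : Type w) [L.Structure A] [L.Structure C] : Prop :=
  ∀ c₁ c₂ : C, c₁ ≠ c₂ → ∃ h : C →[L] A, h c₁ ≠ h c₂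

end Classes

/-! ### Complete atomic types -/

section Types

variable {L : FirstOrder.Language.{u, v}} {n : ℕ}

/-- An atomic type in `x₁, …, xₙ` relative to the theory `T`: a set of atomic formulas and
negations of atomic formulas that is consistent with `T`. -/
structure IsAtomicType (T : L.Theory) (p : Set (L.Formula (Fin n))) : Prop where
  literal : ∀ φ ∈ p, ∃ t s : L.Term (Fin n), φ = t.equal s ∨ φ = (t.equal s).not
  consistent : ∃ (M : Theory.ModelType.{u, v, max u v} T) (a : Fin n → M),
    ∀ φ ∈ p, Formula.Realize φ a

/-- A complete atomic type in `T`: an atomic type that is maximal under inclusion. -/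
def IsCompleteAtomicType (T : L.Theory) (p : Set (L.Formula (Fin n))) : Prop :=
  Maximal (IsAtomicType T) p

theorem IsCompleteAtomicType.exists_realization {T : L.Theory} {p : Set (L.Formula (Fin n))}
    (hp : IsCompleteAtomicType T p) :
    ∃ (M : Theory.ModelType.{u, v, max u v} T) (a : Fin n → M),
      ∀ t s : L.Term (Fin n), t.equal s ∈ p ↔ t.realize a = s.realize a := by
  obtain ⟨M, a, ha⟩ := hp.prop.consistent
  refine ⟨M, a, fun t s => ⟨fun h => Formula.realize_equal.1 (ha _ h), fun h => ?_⟩⟩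
  have hq : IsAtomicType T (insert (t.equal s) p) := by
    refine ⟨?_, M, a, ?_⟩
    · rintro φ (rfl | hφ)
      · exact ⟨t, s, Or.inl rfl⟩
      · exact hp.prop.literal φ hφ
    · rintro φ (rfl | hφ)
      · exact Formula.realize_equal.2 h
      · exact ha φ hφ
  exact hp.le_of_ge hq (Set.subset_insert _ _) (Set.mem_insert _ _)

/-- The congruence on the term algebra given by the atomic formulas in a complete atomic type. -/
def typeCongruence [L.IsAlgebraic] {T : L.Theory} (p : Set (L.Formula (Fin n)))
    (hp : IsCompleteAtomicType T p) : Congruence L (L.Term (Fin n)) where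
  r t s := t.equal s ∈ p
  iseqv := by
    obtain ⟨M, a, h⟩ := hp.exists_realization
    simp only [h]
    exact ⟨fun _ => rfl, fun h => h.symm, fun h h' => h.trans h'⟩
  map_fun f x y := by
    obtain ⟨M, a, h⟩ := hp.exists_realization
    simp only [h]
    exact fun hxy => congrArg (funMap f) (funext hxy)

variable (L) in
/-- `C` is (isomorphic to) the algebra defined by a complete atomic type in the theory `T`. -/
def IsDefinedByCompleteAtomicType [L.IsAlgebraic] (T : L.Theory) (C : Type w) [L.Structure C] :
    Prop :=
  ∃ (n : ℕ) (p : Set (L.Formula (Fin n))) (hp : IsCompleteAtomicType T p),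
    Nonempty (C ≃[L] (typeCongruence p hp).Quot)

end Types

/-! ### Limit algebras -/

section Limits

universe x y

/-- A (consistent) diagram formula in the finite set of variables `X`: the conjunction of all
inequations `a ≠ b` between distinct variables and of finitely many formulas
`F(a₁, …, aₙ) = b`, where `F` is an operation symbol and `a₁, …, aₙ, b` are variables.
The set `facts` lists the conjuncts of the second kind. -/
structure DiagramFormula (L : FirstOrder.Language.{u, v}) (X : Type y) where
  facts : Set (Σ n : ℕ, L.Functions n × (Fin n → X) × X)
  finite_facts : facts.Finite
  functional : ∀ {n : ℕ} (F : L.Functions n) (a : Fin n → X) (b b' : X),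
    ⟨n, F, a, b⟩ ∈ facts → ⟨n, F, a, b'⟩ ∈ facts → b = b'

/-- The diagram formula is true in `M` under the assignment `s`. -/
def DiagramFormula.Realize {L : FirstOrder.Language.{u, v}} {X : Type y} (φ : DiagramFormula L X)
    {M : Type w} [L.Structure M] (s : X → M) : Prop :=
  (∀ a b : X, a ≠ b → s a ≠ s b) ∧
    ∀ (n : ℕ) (F : L.Functions n) (a : Fin n → X) (b : X),
      ⟨n, F, a, b⟩ ∈ φ.facts → funMap F (s ∘ a) = s b

/-- A direct system of diagram formulas `φ i` in finite sets of variables `X i`, over a directed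
index set. The substitutions `γ i j : X i → X j` turn conjuncts of `φ i` into conjuncts of `φ j`
(for the inequations this says that `γ i j` is injective), and each operation symbol applied to
variables of `X i` gets a value in some later `φ j`. -/
structure DiagramSystem (L : FirstOrder.Language.{u, v}) where
  I : Type x
  [order : PartialOrder I]
  [directed : IsDirectedOrder I]
  [nonempty : Nonempty I]
  X : I → Type y
  [finite : ∀ i, Finite (X i)]
  φ : ∀ i, DiagramFormula L (X i)
  γ : ∀ i j : I, i ≤ j → X i ↪ X j
  [system : DirectedSystem X (γ · · ·)]
  map_facts : ∀ (i j : I) (h : i ≤ j) (n : ℕ) (F : L.Functions n) (a : Fin n → X i) (b : X i),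
    ⟨n, F, a, b⟩ ∈ (φ i).facts → ⟨n, F, γ i j h ∘ a, γ i j h b⟩ ∈ (φ j).facts
  total : ∀ (i : I) (n : ℕ) (F : L.Functions n) (a : Fin n → X i),
    ∃ (j : I) (h : i ≤ j) (b : X j), ⟨n, F, γ i j h ∘ a, b⟩ ∈ (φ j).facts

attribute [instance] DiagramSystem.order DiagramSystem.directed DiagramSystem.nonempty
  DiagramSystem.finite DiagramSystem.system

namespace DiagramSystem

variable {L : FirstOrder.Language.{u, v}} (Λ : DiagramSystem.{u, v, x, y} L)

/-- The universe of the limit algebra: the direct limit of the sets of variables. -/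
def Limit : Type (max x y) := DirectLimit Λ.X Λ.γ

variable {Λ} in
/-- The element of the limit represented by a variable `a ∈ X i`. -/
def ofVar (i : Λ.I) (a : Λ.X i) : Λ.Limit :=
  Quotient.mk (DirectLimit.setoid Λ.γ) ⟨i, a⟩

variable {Λ}

theorem ofVar_map {i j : Λ.I} (h : i ≤ j) (a : Λ.X i) : ofVar j (Λ.γ i j h a) = ofVar i a :=
  DirectLimit.mk_apply i j a h

theorem ofVar_injective (i : Λ.I) : Function.Injective (ofVar (Λ := Λ) i) :=
  DirectLimit.mk_injective Λ.γ (fun i j h => (Λ.γ i j h).injective) i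

theorem exists_rep {n : ℕ} (z : Fin n → Λ.Limit) :
    ∃ (i : Λ.I) (a : Fin n → Λ.X i), ∀ k, z k = ofVar i (a k) := by
  have hz : ∀ k, ∃ (i : Λ.I) (a : Λ.X i), z k = ofVar i a := fun k =>
    DirectLimit.exists_eq_mk Λ.γ (z k)
  choose i a ha using hz
  obtain ⟨j, hj⟩ := Finite.exists_le i
  exact ⟨j, fun k => Λ.γ _ _ (hj k) (a k), fun k => (ha k).trans (ofVar_map _ _).symm⟩

/-- In the limit, `F(z₁, …, zₙ) = c` if some `φ i` has a conjunct `F(a₁, …, aₙ) = b` with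
`zₖ` represented by `aₖ` and `c` by `b`. -/
def LimitFact {n : ℕ} (F : L.Functions n) (z : Fin n → Λ.Limit) (c : Λ.Limit) : Prop :=
  ∃ (i : Λ.I) (a : Fin n → Λ.X i) (b : Λ.X i),
    ⟨n, F, a, b⟩ ∈ (Λ.φ i).facts ∧ (∀ k, z k = ofVar i (a k)) ∧ c = ofVar i b

theorem limitFact_existsUnique {n : ℕ} (F : L.Functions n) (z : Fin n → Λ.Limit) :
    ∃! c, LimitFact F z c := by
  obtain ⟨i, a, ha⟩ := exists_rep z
  obtain ⟨j, h, b, hb⟩ := Λ.total i n F a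
  refine ⟨ofVar j b, ⟨j, _, b, hb, fun k => (ha k).trans (ofVar_map h _).symm, rfl⟩, ?_⟩
  rintro c ⟨i', a', b', hb', ha', rfl⟩
  obtain ⟨k, hjk, hik⟩ := exists_ge_ge j i'
  have h₁ := Λ.map_facts j k hjk n F _ b hb
  have h₂ := Λ.map_facts i' k hik n F _ b' hb'
  have heq : Λ.γ i' k hik ∘ a' = Λ.γ j k hjk ∘ (Λ.γ i j h ∘ a) := by
    funext l
    apply ofVar_injective k
    simp only [Function.comp_apply, ofVar_map]
    exact (ha' l).symm.trans (ha l)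
  rw [heq] at h₂
  have := (Λ.φ k).functional F _ _ _ h₂ h₁
  rw [← ofVar_map hik, ← ofVar_map hjk, this]

/-- The limit algebra of a direct system of diagram formulas. -/
instance limitStructure [L.IsAlgebraic] : L.Structure Λ.Limit where
  funMap F z := Classical.choose (limitFact_existsUnique F z).exists
  RelMap {n} r _ := isEmptyElim r

theorem limitFact_funMap [L.IsAlgebraic] {n : ℕ} (F : L.Functions n) (z : Fin n → Λ.Limit) :
    LimitFact F z (funMap F z) :=
  Classical.choose_spec (limitFact_existsUnique F z).exists

variable (Λ) in
/-- The direct system is over `A` if each of its formulas is realized in `A`. -/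
def IsOver (A : Type w) [L.Structure A] : Prop :=
  ∀ i, ∃ s : Λ.X i → A, (Λ.φ i).Realize s

end DiagramSystem

/-- `B` is a limit algebra over `A`: it is (isomorphic to) the limit algebra of some direct
system of diagram formulas over `A`. -/
def IsLimitAlgebra (L : FirstOrder.Language.{u, v}) [L.IsAlgebraic] (A B : Type w) [L.Structure A]
    [L.Structure B] : Prop :=
  ∃ Λ : DiagramSystem.{u, v, max u w, w} L, Λ.IsOver A ∧ Nonempty (B ≃[L] Λ.Limit)

/-- `C` is a subdirect product of finitely many limit algebras over `A`: it embeds into a direct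
product of a finite (possibly empty) family of limit algebras over `A` so that all projections
to the factors are surjective on `C`. -/
def IsFiniteSubdirectProductOfLimits (L : FirstOrder.Language.{u, v}) [L.IsAlgebraic] (A C : Type w)
    [L.Structure A] [L.Structure C] : Prop :=
  ∃ (k : ℕ) (B : Fin k → Type w) (_ : ∀ i, L.Structure (B i)),
    (∀ i, IsLimitAlgebra L A (B i)) ∧
      ∃ e : C ↪[L] (∀ i, B i), ∀ i, Function.Surjective fun c => e c i

end Limits

end

end UAG

namespace UAG

open FirstOrder FirstOrder.Language FirstOrder.Language.Structure

/-! ### Quasi-identities and their preservation -/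

section QuasiIdentities

variable {L : FirstOrder.Language.{u, v}}

/-! The hub is separation by homomorphisms. Homomorphisms preserve the premises of a quasi-identity,
and a failing conclusion stays failing under a homomorphism that separates its two sides
(`model_quasiTheory_of_separating`). This gives `InQvar` from complete atomic types and from
subdirect products of limits. Separation, `InPvar` and `EmbedsInPower` are equivalent by formal
arguments.

The Noetherian hypothesis enters twice. First, let `S` be all equations true at a generating tuple
`c` of `C`. A finite `S₀ ⊆ S` with the same solutions in `A` turns "`t = s` holds on the zero set of
`S`" into a quasi-identity of `A`. It therefore holds in `C` at `c`, so `C` is the coordinate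
algebra of that zero set, whose points separate `C`.

Second, the sets of homomorphisms `C → A` cut out by equations satisfy the descending chain
condition. Hence all homomorphisms are covered by finitely many sets `Y` with `C / rad Y`
discriminated by `A` (`exists_decomposition`). A discriminated algebra is a limit algebra: a
homomorphism injective on a finite set realizes its finite diagram. Conversely, finitely many terms
in a limit are evaluated at one stage, whose realization in `A` preserves and reflects their
equalities (`exists_realize_eq_iff`), so limits inherit the quasi-identities of `A`. -/

theorem realize_quasiIdentity {M : Type*} [L.Structure M] {n : ℕ}
    (E : List (L.Term (Empty ⊕ Fin n) × L.Term (Empty ⊕ Fin n)))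
    (e : L.Term (Empty ⊕ Fin n) × L.Term (Empty ⊕ Fin n)) :
    M ⊨ quasiIdentity E e ↔ ∀ x : Fin n → M,
      (∀ d ∈ E, d.1.realize (Sum.elim default x) = d.2.realize (Sum.elim default x)) →
        e.1.realize (Sum.elim default x) = e.2.realize (Sum.elim default x) := by
  rw [quasiIdentity, Sentence.Realize, BoundedFormula.realize_alls]
  simp only [BoundedFormula.realize_imp, BoundedFormula.realize_foldr_inf, List.mem_map,
    forall_exists_index, and_imp, forall_apply_eq_imp_iff₂, BoundedFormula.realize_bdEqual]

theorem realize_relabel_inr {M : Type*} [L.Structure M] {n : ℕ} (t : L.Term (Fin n))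
    (x : Fin n → M) :
    (t.relabel (Sum.inr : Fin n → Empty ⊕ Fin n)).realize (Sum.elim default x) = t.realize x := by
  simp [Term.realize_relabel]

theorem realize_relabel_elim {M : Type*} [L.Structure M] {n : ℕ} (t : L.Term (Empty ⊕ Fin n))
    (x : Fin n → M) :
    (t.relabel (Sum.elim Empty.elim id : Empty ⊕ Fin n → Fin n)).realize x =
      t.realize (Sum.elim default x) := by
  rw [Term.realize_relabel]
  refine congrArg (fun f => t.realize f) (funext fun i => ?_)
  rcases i with i | i
  exacts [i.elim, rfl]

/-- Relabelling between `Empty ⊕ Fin n` and `Fin n` preserves values in both directions, so later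
arguments can ignore sentences and work with implications between equations. -/
theorem model_quasiTheory_iff {A : Type w} [L.Structure A] {M : Type*} [L.Structure M] :
    (quasiTheory L A).Model M ↔ ∀ (n : ℕ) (E : List (Equation L n)) (e : Equation L n),
      (∀ x : Fin n → A, (∀ d ∈ E, d.1.realize x = d.2.realize x) → e.1.realize x = e.2.realize x) →
      ∀ x : Fin n → M, (∀ d ∈ E, d.1.realize x = d.2.realize x) →
        e.1.realize x = e.2.realize x := by
  constructor
  · intro h n E e hA
    let r : L.Term (Fin n) → L.Term (Empty ⊕ Fin n) := Term.relabel Sum.inr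
    have hmem : quasiIdentity (E.map fun d => (r d.1, r d.2)) (r e.1, r e.2) ∈ quasiTheory L A := by
      refine ⟨⟨n, _, _, rfl⟩, ?_⟩
      rw [realize_quasiIdentity]
      simpa only [List.forall_mem_map, realize_relabel_inr, r] using hA
    have := h.realize_of_mem _ hmem
    rw [realize_quasiIdentity] at this
    simpa only [List.forall_mem_map, realize_relabel_inr, r] using this
  · intro h
    refine ⟨?_⟩
    rintro _ ⟨⟨n, E, e, rfl⟩, hA⟩
    let r : L.Term (Empty ⊕ Fin n) → L.Term (Fin n) := Term.relabel (Sum.elim Empty.elim id)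
    rw [realize_quasiIdentity] at hA ⊢
    have := h n (E.map fun d => (r d.1, r d.2)) (r e.1, r e.2) (by
      simpa only [List.forall_mem_map, realize_relabel_elim, r] using hA)
    simpa only [List.forall_mem_map, realize_relabel_elim, r] using this

theorem quasiTheory_subset_iff {A C : Type w} [L.Structure A] [L.Structure C] :
    quasiTheory L A ⊆ quasiTheory L C ↔ InQvar L A C :=
  ⟨fun h => ⟨fun _ hφ => (h hφ).2⟩, fun h _ hφ => ⟨hφ.1, h.realize_of_mem _ hφ⟩⟩

theorem model_quasiTheory_self (A : Type w) [L.Structure A] : (quasiTheory L A).Model A :=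
  ⟨fun _ hφ => hφ.2⟩

/-- A structure whose points are separated by homomorphisms to models of a quasi-equational
theory is itself a model of that theory. -/
theorem model_quasiTheory_of_separating {A : Type w} [L.Structure A] {M : Type*} [L.Structure M]
    {ι : Type*} (N : ι → Type*) [∀ i, L.Structure (N i)]
    (hN : ∀ i, (quasiTheory L A).Model (N i))
    (h : ∀ x y : M, x ≠ y → ∃ (i : ι) (f : M →[L] N i), f x ≠ f y) :
    (quasiTheory L A).Model M := by
  rw [model_quasiTheory_iff]
  intro n E e hA x hx
  by_contra hne
  obtain ⟨i, f, hf⟩ := h _ _ hne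
  apply hf
  rw [← HomClass.realize_term, ← HomClass.realize_term]
  refine model_quasiTheory_iff.1 (hN i) n E e hA _ fun d hd => ?_
  rw [HomClass.realize_term, HomClass.realize_term, hx d hd]

end QuasiIdentities

/-! ### Homomorphisms, quotients and term algebras -/

section Quotients

variable {L : FirstOrder.Language.{u, v}} [L.IsAlgebraic]

/-- A map commuting with the operations is a homomorphism of algebras. -/
def homOfFunMap {M N : Type*} [L.Structure M] [L.Structure N] (f : M → N)
    (hf : ∀ {n : ℕ} (F : L.Functions n) (x : Fin n → M), f (funMap F x) = funMap F (f ∘ x)) :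
    M →[L] N where
  toFun := f
  map_fun' := hf
  map_rel' {_} r := isEmptyElim r

/-- An injective homomorphism of algebras is an embedding. -/
def embeddingOfInjective {M N : Type*} [L.Structure M] [L.Structure N] (f : M →[L] N)
    (hf : Function.Injective f) : M ↪[L] N where
  toFun := f
  inj' := hf
  map_fun' := f.map_fun
  map_rel' {_} r := isEmptyElim r

/-- A bijective homomorphism of algebras is an isomorphism. -/
noncomputable def equivOfBijective {M N : Type*} [L.Structure M] [L.Structure N] (f : M →[L] N)
    (hf : Function.Bijective f) : M ≃[L] N where
  toEquiv := Equiv.ofBijective f hf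
  map_fun' := f.map_fun
  map_rel' {_} r := isEmptyElim r

/-- The canonical projection onto a quotient algebra. -/
def Congruence.mkHom {M : Type*} [L.Structure M] (θ : Congruence L M) : M →[L] θ.Quot :=
  homOfFunMap (fun x => (Quotient.mk θ.toSetoid x : Quotient θ.toSetoid)) fun F x =>
    (funMap_quotient_mk' (s := θ.toSetoid) F x).symm

theorem Congruence.mkHom_surjective {M : Type*} [L.Structure M] (θ : Congruence L M) :
    Function.Surjective θ.mkHom := Quotient.mk_surjective

theorem Congruence.mkHom_eq_iff {M : Type*} [L.Structure M] (θ : Congruence L M) {x y : M} :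
    θ.mkHom x = θ.mkHom y ↔ θ.r x y := Quotient.eq (r := θ.toSetoid)

theorem Congruence.funMap_mkHom {M : Type*} [L.Structure M] (θ : Congruence L M) {n : ℕ}
    (F : L.Functions n) (x : Fin n → M) :
    funMap F (fun i => θ.mkHom (x i)) = θ.mkHom (funMap F x) :=
  (θ.mkHom.map_fun F x).symm

/-- A homomorphism constant on the classes of `θ` factors through the quotient. -/
theorem Congruence.exists_lift {M N : Type*} [L.Structure M] [L.Structure N] (θ : Congruence L M)
    (f : M →[L] N) (hf : ∀ x y, θ.r x y → f x = f y) :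
    ∃ g : θ.Quot →[L] N, ∀ x, g (θ.mkHom x) = f x := by
  let g₀ : θ.Quot → N := fun q => Quotient.lift (s := θ.toSetoid) f hf q
  have hg₀ : ∀ x, g₀ (θ.mkHom x) = f x := fun _ => rfl
  refine ⟨homOfFunMap g₀ fun F x => ?_, hg₀⟩
  choose y hy using fun i => θ.mkHom_surjective (x i)
  obtain rfl : x = fun i => θ.mkHom (y i) := funext fun i => (hy i).symm
  rw [θ.funMap_mkHom, hg₀, f.map_fun]
  rfl

/-- Evaluation of terms, as a homomorphism from the term algebra. -/
def realizeHom {α : Type*} {M : Type*} [L.Structure M] (a : α → M) : L.Term α →[L] M :=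
  homOfFunMap (fun t => t.realize a) fun _ _ => rfl

theorem nonempty_equiv_quot_of_surjective {M N : Type*} [L.Structure M] [L.Structure N]
    (θ : Congruence L M) (f : M →[L] N) (hf : Function.Surjective f)
    (hθ : ∀ x y, θ.r x y ↔ f x = f y) : Nonempty (N ≃[L] θ.Quot) := by
  obtain ⟨g, hg⟩ := θ.exists_lift f fun x y h => (hθ x y).1 h
  refine ⟨(equivOfBijective g ⟨fun p q hpq => ?_, fun c => ?_⟩).symm⟩
  · obtain ⟨x, rfl⟩ := θ.mkHom_surjective p
    obtain ⟨y, rfl⟩ := θ.mkHom_surjective q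
    rw [hg, hg] at hpq
    exact θ.mkHom_eq_iff.2 ((hθ x y).2 hpq)
  · obtain ⟨x, rfl⟩ := hf c
    exact ⟨_, hg x⟩

omit [L.IsAlgebraic] in
/-- A nonempty finitely generated algebra is the image of a term algebra in finitely many
(and at least one) variables. -/
theorem exists_realize_surjective {C : Type*} [L.Structure C] [Nonempty C]
    (hC : FirstOrder.Language.Structure.FG L C) :
    ∃ (n : ℕ) (c : Fin n → C), 0 < n ∧
      Function.Surjective fun t : L.Term (Fin n) => t.realize c := by
  classical
  obtain ⟨S, hS⟩ := Structure.fg_def.1 hC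
  -- The extra generator makes the number of variables positive, as the Noetherian hypothesis
  -- requires.
  let S' : Finset C := insert (Classical.arbitrary C) S
  let e := S'.equivFin
  refine ⟨S'.card, fun i => e.symm i, Finset.card_pos.2 ⟨_, Finset.mem_insert_self _ _⟩,
    fun x => ?_⟩
  have hx : x ∈ Substructure.closure L (S : Set C) := by rw [hS]; trivial
  obtain ⟨t, ht⟩ := Substructure.mem_closure_iff_exists_term.1 hx
  refine ⟨t.relabel fun s : (S : Set C) => e ⟨s, Finset.mem_insert_of_mem s.2⟩, ?_⟩
  simp only [Term.realize_relabel]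
  rw [← ht]
  exact congrArg (fun f => t.realize f) (funext fun s => by simp)

end Quotients

/-! ### Separation, prevarieties and powers -/

section Separation

variable {L : FirstOrder.Language.{u, v}} [L.IsAlgebraic] {A C : Type w} [L.Structure A]
  [L.Structure C]

omit [L.IsAlgebraic] in
theorem IsSeparatedBy.inQvar (h : IsSeparatedBy L A C) : InQvar L A C :=
  model_quasiTheory_of_separating (fun _ : Unit => A) (fun _ => model_quasiTheory_self A)
    fun x y hxy => let ⟨f, hf⟩ := h x y hxy; ⟨(), f, hf⟩

theorem isPrevariety_isSeparatedBy (A : Type w) [L.Structure A] :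
    IsPrevariety L fun M _ => IsSeparatedBy L A M where
  iso M N _ _ e h c₁ c₂ hc := by
    obtain ⟨f, hf⟩ := h (e.symm c₁) (e.symm c₂) (e.symm.injective.ne hc)
    exact ⟨f.comp e.symm.toHom, hf⟩
  sub M _ S _ h c₁ c₂ hc := by
    obtain ⟨f, hf⟩ := h c₁ c₂ (Subtype.coe_injective.ne hc)
    exact ⟨f.comp S.subtype.toHom, hf⟩
  prod I M _ h c₁ c₂ hc := by
    obtain ⟨i, hi⟩ := Function.ne_iff.1 hc
    obtain ⟨f, hf⟩ := h i _ _ hi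
    exact ⟨f.comp (homOfFunMap (fun x : ∀ i, M i => x i) fun _ _ => rfl), hf⟩

/-- The algebras separated by `A` form a prevariety, and it contains `A` because the identity
separates points. -/
theorem InPvar.isSeparatedBy (h : InPvar L A C) : IsSeparatedBy L A C :=
  h _ (isPrevariety_isSeparatedBy A) fun _ _ hc => ⟨Hom.id L A, hc⟩

theorem IsSeparatedBy.embedsInPower (h : IsSeparatedBy L A C) : EmbedsInPower L A C := by
  choose f hf using h
  -- One coordinate for each pair of distinct elements, filled by a homomorphism separating that
  -- pair.
  refine ⟨{p : C × C // p.1 ≠ p.2}, ⟨embeddingOfInjective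
    (homOfFunMap (fun c p => f p.1.1 p.1.2 p.2 c) fun F x => funext fun p =>
      (f _ _ _).map_fun F x) fun c d hcd => ?_⟩⟩
  by_contra hne
  exact hf c d hne (congrFun hcd ⟨(c, d), hne⟩)

omit [L.IsAlgebraic] in
theorem EmbedsInPower.inPvar [Nonempty C] (h : EmbedsInPower L A C) : InPvar L A C := by
  intro K hK hA
  obtain ⟨I, ⟨e⟩⟩ := h
  exact hK.iso _ _ e.equivRange.symm
    (hK.sub _ _ ⟨_, (e.equivRange (Classical.arbitrary C)).2⟩ (hK.prod I _ fun _ => hA))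

end Separation

/-! ### Coordinate algebras -/

section CoordinateAlgebras

variable {L : FirstOrder.Language.{u, v}} [L.IsAlgebraic] {A C : Type w} [L.Structure A]
  [L.Structure C]

theorem InQvar.isCoordinateAlgebra [Nonempty C] (hA : IsEquationallyNoetherian L A)
    (hC : FirstOrder.Language.Structure.FG L C) (h : InQvar L A C) :
    IsCoordinateAlgebra L A C := by
  obtain ⟨n, c, hn, hc⟩ := exists_realize_surjective hC
  let S : Set (Equation L n) := {e | e.1.realize c = e.2.realize c}
  obtain ⟨S₀, hS₀, hfin, heq⟩ := hA n hn S
  refine ⟨n, zeroSet A S, ⟨S, rfl⟩, nonempty_equiv_quot_of_surjective _ (realizeHom c) hc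
    fun t s => ⟨fun hts => ?_, fun hts p hp => hp (t, s) hts⟩⟩
  -- The quasi-identity `⋀ S₀ → t = s` holds in `A` because `S₀` and `S` have the same zeros there;
  -- it is applied in `C` at `c`.
  refine model_quasiTheory_iff.1 h n hfin.toFinset.toList (t, s) (fun x hx => ?_) c fun d hd => ?_
  · refine hts x ?_
    rw [heq]
    exact fun d hd => hx d (by simpa using hd)
  · exact hS₀ (by simpa using hd)

/-- Evaluation at a point of `Y` factors through the coordinate algebra, and terms in distinct
classes differ at some point of `Y`. -/
theorem IsCoordinateAlgebra.isSeparatedBy (h : IsCoordinateAlgebra L A C) :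
    IsSeparatedBy L A C := by
  obtain ⟨n, Y, -, ⟨e⟩⟩ := h
  intro c d hcd
  obtain ⟨t, ht⟩ := (radicalCongruence L Y).mkHom_surjective (e c)
  obtain ⟨s, hs⟩ := (radicalCongruence L Y).mkHom_surjective (e d)
  have hts : ¬ (radicalCongruence L Y).r t s := by
    rw [← Congruence.mkHom_eq_iff, ht, hs]
    exact e.injective.ne hcd
  have : ∃ p ∈ Y, t.realize p ≠ s.realize p := by
    by_contra hcon
    push Not at hcon
    exact hts hcon
  obtain ⟨p, hp, hne⟩ := this
  obtain ⟨g, hg⟩ := (radicalCongruence L Y).exists_lift (realizeHom p) fun x y hxy => hxy p hp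
  refine ⟨g.comp e.toHom, ?_⟩
  change g (e c) ≠ g (e d)
  rw [← ht, ← hs, hg, hg]
  exact hne

end CoordinateAlgebras

/-! ### Complete atomic types -/

section AtomicTypes

variable {L : FirstOrder.Language.{u, v}}

/-- At a given tuple every atomic formula or its negation is true, so adding a false literal would
put a formula together with its negation. -/
theorem isCompleteAtomicType_literals {T : L.Theory} {n : ℕ}
    (M : Theory.ModelType.{u, v, max u v} T) (a : Fin n → M) :
    IsCompleteAtomicType T {φ : L.Formula (Fin n) |
      (∃ t s : L.Term (Fin n), φ = t.equal s ∨ φ = (t.equal s).not) ∧ φ.Realize a} := by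
  refine ⟨⟨fun φ hφ => hφ.1, M, a, fun φ hφ => hφ.2⟩, fun q hq hle φ hφ => ?_⟩
  obtain ⟨N, b, hb⟩ := hq.consistent
  refine ⟨hq.literal φ hφ, ?_⟩
  obtain ⟨t, s, rfl | rfl⟩ := hq.literal φ hφ
  · by_contra hne
    exact Formula.realize_not.1 (hb _ (hle ⟨⟨t, s, Or.inr rfl⟩, Formula.realize_not.2 hne⟩))
      (hb _ hφ)
  · rw [Formula.realize_not]
    intro heq
    exact Formula.realize_not.1 (hb _ hφ) (hb _ (hle ⟨⟨t, s, Or.inl rfl⟩, heq⟩))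

variable [L.IsAlgebraic] {A C : Type w} [L.Structure A] [L.Structure C]

theorem InQvar.isDefinedByCompleteAtomicType [Nonempty C]
    (hC : FirstOrder.Language.Structure.FG L C) (h : InQvar L A C) :
    IsDefinedByCompleteAtomicType L (quasiTheory L A) C := by
  obtain ⟨n, c, -, hc⟩ := exists_realize_surjective hC
  let θ : Congruence L (L.Term (Fin n)) :=
    { r := fun t s => t.realize c = s.realize c
      iseqv := ⟨fun _ => rfl, fun h => h.symm, fun h h' => h.trans h'⟩
      map_fun := fun f _ _ hxy => congrArg (funMap f) (funext hxy) }
  obtain ⟨g⟩ := nonempty_equiv_quot_of_surjective θ (realizeHom c) hc fun _ _ => Iff.rfl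
  -- Consistency asks for a model in universe `max u v`, whereas `C` lives in `w`; the quotient of
  -- the term algebra supplies a copy of `C` there.
  let e : C ≃ ULift.{max u v} θ.Quot := g.toEquiv.trans Equiv.ulift.symm
  let : L.Structure (ULift.{max u v} θ.Quot) := e.inducedStructure
  let E : C ≃[L] ULift.{max u v} θ.Quot := e.inducedStructureEquiv
  have : Nonempty (ULift.{max u v} θ.Quot) := Nonempty.map e ‹_›
  have : (quasiTheory L A).Model (ULift.{max u v} θ.Quot) :=
    model_quasiTheory_of_separating (fun _ : Unit => C) (fun _ => h) fun x y hxy =>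
      ⟨(), E.symm.toHom, E.symm.injective.ne hxy⟩
  let M : Theory.ModelType.{u, v, max u v} (quasiTheory L A) := .of _ (ULift.{max u v} θ.Quot)
  refine ⟨n, _, isCompleteAtomicType_literals M (E ∘ c),
    nonempty_equiv_quot_of_surjective _ (realizeHom c) hc fun t s => ?_⟩
  change (_ ∧ (t.equal s).Realize (E ∘ c)) ↔ t.realize c = s.realize c
  rw [and_iff_right ⟨t, s, Or.inl rfl⟩, Formula.realize_equal]
  change t.realize (E ∘ c) = s.realize (E ∘ c) ↔ _
  rw [HomClass.realize_term, HomClass.realize_term]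
  exact E.injective.eq_iff

/-- Evaluation at a realization of the type embeds `C` into a model of the quasi-equational theory.
-/
theorem IsDefinedByCompleteAtomicType.inQvar
    (h : IsDefinedByCompleteAtomicType L (quasiTheory L A) C) : InQvar L A C := by
  obtain ⟨n, p, hp, ⟨e⟩⟩ := h
  obtain ⟨M, a, ha⟩ := hp.exists_realization
  obtain ⟨g, hg⟩ := (typeCongruence p hp).exists_lift (realizeHom a) fun t s hts => (ha t s).1 hts
  refine model_quasiTheory_of_separating (fun _ : Unit => M) (fun _ => M.is_model) fun c d hcd =>
    ⟨(), g.comp e.toHom, ?_⟩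
  obtain ⟨t, ht⟩ := (typeCongruence p hp).mkHom_surjective (e c)
  obtain ⟨s, hs⟩ := (typeCongruence p hp).mkHom_surjective (e d)
  change g (e c) ≠ g (e d)
  rw [← ht, ← hs, hg, hg]
  intro heq
  apply hcd
  apply e.injective
  rw [← ht, ← hs, Congruence.mkHom_eq_iff]
  exact (ha t s).2 heq

end AtomicTypes

/-! ### Limit algebras satisfy the quasi-identities -/

section LimitsSatisfyQuasiIdentities

universe x y

variable {L : FirstOrder.Language.{u, v}}

theorem DiagramSystem.γ_γ {Λ : DiagramSystem.{u, v, x, y} L} {i j k : Λ.I} (hij : i ≤ j)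
    (hjk : j ≤ k) (a : Λ.X i) : Λ.γ j k hjk (Λ.γ i j hij a) = Λ.γ i k (hij.trans hjk) a :=
  DirectedSystem.map_map' (f := Λ.γ) hij hjk a

theorem DiagramFormula.Realize.comp_γ {Λ : DiagramSystem.{u, v, x, y} L} {A : Type w}
    [L.Structure A] {i j : Λ.I} (h : i ≤ j) {s : Λ.X j → A} (hs : (Λ.φ j).Realize s) :
    (Λ.φ i).Realize (s ∘ Λ.γ i j h) :=
  ⟨fun _ _ hab => hs.1 _ _ ((Λ.γ i j h).injective.ne hab), fun n F a b hab =>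
    hs.2 n F _ _ (Λ.map_facts i j h n F a b hab)⟩

variable [L.IsAlgebraic]

open DiagramSystem

theorem DiagramSystem.ofVar_funMap {Λ : DiagramSystem.{u, v, x, y} L} {i : Λ.I} {n : ℕ}
    {F : L.Functions n} {a : Fin n → Λ.X i} {b : Λ.X i} (h : ⟨n, F, a, b⟩ ∈ (Λ.φ i).facts) :
    funMap F (fun k => ofVar i (a k)) = ofVar i b :=
  (limitFact_existsUnique F _).unique (limitFact_funMap F _) ⟨i, a, b, h, fun _ => rfl, rfl⟩

/-- The value of a term in the limit is represented by a variable at a stage that determines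
the value of the term in every realization. -/
theorem DiagramSystem.exists_term_value {Λ : DiagramSystem.{u, v, x, y} L} (A : Type w)
    [L.Structure A] {α : Type*} {i : Λ.I} (a : α → Λ.X i) (t : L.Term α) :
    ∃ (j : Λ.I) (h : i ≤ j) (b : Λ.X j), t.realize (fun k => ofVar i (a k)) = ofVar j b ∧
      ∀ s : Λ.X j → A, (Λ.φ j).Realize s → t.realize (fun k => s (Λ.γ i j h (a k))) = s b := by
  induction t with
  | var k => exact ⟨i, le_rfl, Λ.γ i i le_rfl (a k), (ofVar_map _ _).symm, fun s _ => rfl⟩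
  | @func l F ts ih =>
    choose j hj b hb hs using ih
    obtain ⟨m, hm⟩ := Finite.exists_le j
    -- For a constant symbol the family `j` is empty, so `i ≤ m` is not automatic.
    obtain ⟨m', hm'⟩ := exists_ge_ge m i
    have hjm : ∀ k, j k ≤ m' := fun k => (hm k).trans hm'.1
    obtain ⟨q, hq, d, hd⟩ := Λ.total m' l F fun k => Λ.γ (j k) m' (hjm k) (b k)
    refine ⟨q, hm'.2.trans hq, d, ?_, fun s hsq => ?_⟩
    · rw [← ofVar_funMap hd]
      simp only [Term.realize, Function.comp_apply, ofVar_map, hb]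
    · rw [← hsq.2 l F _ d hd]
      simp only [Term.realize]
      congr 1
      funext k
      have := hs k _ (hsq.comp_γ ((hjm k).trans hq))
      simp only [Function.comp_apply] at this ⊢
      rw [γ_γ, ← this]
      congr 1
      funext k'
      rw [γ_γ]

/-- All the values are represented by variables at one stage. A realization of that stage in `A` is
injective, thanks to the inequations, so it reflects equalities as well as preserving them. -/
theorem DiagramSystem.IsOver.exists_realize_eq_iff {Λ : DiagramSystem.{u, v, x, y} L} {A : Type w}
    [L.Structure A] (hΛ : Λ.IsOver A) {n : ℕ} (z : Fin n → Λ.Limit) {ι : Type*} [Finite ι]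
    (t : ι → L.Term (Fin n)) :
    ∃ x : Fin n → A, ∀ p q, (t p).realize x = (t q).realize x ↔
      (t p).realize z = (t q).realize z := by
  obtain ⟨i, a, ha⟩ := exists_rep z
  obtain rfl : z = fun k => ofVar i (a k) := funext ha
  choose j hj b hb hs using fun p => exists_term_value A a (t p)
  obtain ⟨m, hm⟩ := Finite.exists_le j
  obtain ⟨m', hm'⟩ := exists_ge_ge m i
  obtain ⟨s, hsm⟩ := hΛ m'
  have hjm : ∀ p, j p ≤ m' := fun p => (hm p).trans hm'.1
  have hval : ∀ p, (t p).realize (fun k => s (Λ.γ i m' hm'.2 (a k))) =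
      s (Λ.γ (j p) m' (hjm p) (b p)) := fun p => by
    have := hs p _ (hsm.comp_γ (hjm p))
    simp only [Function.comp_apply] at this
    rw [← this]
    congr 1
    funext k
    rw [γ_γ]
  have hinj : Function.Injective s := fun p q h => by
    by_contra hne
    exact hsm.1 _ _ hne h
  refine ⟨fun k => s (Λ.γ i m' hm'.2 (a k)), fun p q => ?_⟩
  rw [hval, hval, hinj.eq_iff, hb, hb, ← (ofVar_injective m').eq_iff, ofVar_map, ofVar_map]

theorem DiagramSystem.IsOver.model_quasiTheory {Λ : DiagramSystem.{u, v, x, y} L} {A : Type w}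
    [L.Structure A] (hΛ : Λ.IsOver A) : (quasiTheory L A).Model Λ.Limit := by
  rw [model_quasiTheory_iff]
  intro n E e hE z hz
  have : Finite {d // d ∈ e :: E} := List.finite_toSet (e :: E)
  -- The two summands index the left and the right sides of the premises and the conclusion.
  obtain ⟨x, hx⟩ := hΛ.exists_realize_eq_iff z
    (ι := {d // d ∈ e :: E} ⊕ {d // d ∈ e :: E}) (Sum.elim (fun d => d.1.1) fun d => d.1.2)
  have key : ∀ d ∈ e :: E, d.1.realize x = d.2.realize x ↔ d.1.realize z = d.2.realize z :=
    fun d hd => hx (Sum.inl ⟨d, hd⟩) (Sum.inr ⟨d, hd⟩)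
  exact (key e (by simp)).1 (hE x fun d hd => (key d (by simp [hd])).2 (hz d hd))

theorem IsFiniteSubdirectProductOfLimits.inQvar {A C : Type w} [L.Structure A] [L.Structure C]
    (h : IsFiniteSubdirectProductOfLimits L A C) : InQvar L A C := by
  obtain ⟨k, B, _, hB, e, -⟩ := h
  refine model_quasiTheory_of_separating B (fun i => ?_) fun x y hxy => ?_
  · obtain ⟨Λ, hΛ, ⟨g⟩⟩ := hB i
    exact model_quasiTheory_of_separating (fun _ : Unit => Λ.Limit)
      (fun _ => hΛ.model_quasiTheory) fun x y hxy => ⟨(), g.toHom, g.injective.ne hxy⟩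
  · obtain ⟨i, hi⟩ := Function.ne_iff.1 (e.injective.ne hxy)
    exact ⟨i, (homOfFunMap (fun x : ∀ i, B i => x i) fun _ _ => rfl).comp e.toHom, hi⟩

end LimitsSatisfyQuasiIdentities

/-! ### Discriminated algebras are limit algebras -/

section Discrimination

variable (L : FirstOrder.Language.{u, v})

/-- `B` is discriminated by `A`: every finite subset of `B` is mapped injectively into `A` by some
homomorphism. -/
def IsDiscriminatedBy (A B : Type w) [L.Structure A] [L.Structure B] : Prop :=
  ∀ S : Finset B, ∃ h : B →[L] A, Set.InjOn h S

variable {L}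

/-- The diagram formulas of the finite partial subalgebras of `B`: the variables are the elements
of a finite set, and the conjuncts record finitely many values of operations. -/
noncomputable def finiteDiagramSystem (B : Type w) [L.Structure B] :
    DiagramSystem.{u, v, max u w, w} L :=
  letI : DecidableEq B := Classical.decEq _
  letI : DecidableEq (Σ n : ℕ, L.Functions n × (Fin n → B)) := Classical.decEq _
  { I := Finset B × Finset (Σ n : ℕ, L.Functions n × (Fin n → B))
    order := inferInstanceAs (PartialOrder (Finset B × Finset (Σ n : ℕ, L.Functions n × (Fin n → B))))
    X := fun i => i.1
    φ := fun i =>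
      -- The index lists only operations with their arguments; the value is the one computed in `B`,
      -- and the fact is present only if arguments and value are variables.
      { facts := {f | (⟨f.1, f.2.1, fun k => f.2.2.1 k⟩ :
            Σ n : ℕ, L.Functions n × (Fin n → B)) ∈ i.2 ∧
          funMap f.2.1 (fun k => (f.2.2.1 k : B)) = f.2.2.2}
        finite_facts := by
          refine Set.Finite.of_finite_image (f := fun f : Σ n : ℕ, L.Functions n × (Fin n → i.1) × i.1 =>
            (⟨f.1, f.2.1, fun k => f.2.2.1 k⟩ : Σ n : ℕ, L.Functions n × (Fin n → B)))
            (i.2.finite_toSet.subset ?_) ?_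
          · rintro _ ⟨f, hf, rfl⟩
            exact hf.1
          · rintro ⟨n, F, a, b⟩ hf ⟨n', F', a', b'⟩ hf' heq
            simp only [Sigma.mk.injEq] at heq
            obtain ⟨rfl, heq⟩ := heq
            simp only [heq_eq_eq, Prod.mk.injEq] at heq
            obtain ⟨rfl, ha⟩ := heq
            obtain rfl : a = a' := funext fun k => Subtype.ext (congrFun ha k)
            obtain rfl : b = b' := Subtype.ext (hf.2.symm.trans hf'.2)
            rfl
        functional := fun F a b b' h h' => Subtype.ext (h.2.symm.trans h'.2) }
    γ := fun i j h => Subtype.impEmbedding (· ∈ i.1) (· ∈ j.1) fun _ ha => h.1 ha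
    system := ⟨fun _ _ => rfl, fun _ _ _ _ _ _ => rfl⟩
    map_facts := fun i j h n F a b hf => ⟨h.2 hf.1, hf.2⟩
    total := fun i n F a =>
      ⟨(insert (funMap F fun k => (a k : B)) i.1, insert ⟨n, F, fun k => a k⟩ i.2),
        ⟨Finset.subset_insert _ _, Finset.subset_insert _ _⟩, ⟨_, Finset.mem_insert_self _ _⟩,
        Finset.mem_insert_self _ _, rfl⟩ }

variable [L.IsAlgebraic]

/-- Every algebra is the limit of its own finite diagrams: a variable at any stage represents the
element of `B` that it is. -/
theorem nonempty_equiv_limit_finiteDiagramSystem (B : Type w) [L.Structure B] :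
    Nonempty (B ≃[L] (finiteDiagramSystem (L := L) B).Limit) := by
  let Λ := finiteDiagramSystem (L := L) B
  let f : B → Λ.Limit := fun b =>
    DiagramSystem.ofVar (Λ := Λ) ({b}, ∅) ⟨b, Finset.mem_singleton_self b⟩
  have hf : ∀ (i : Λ.I) (a : Λ.X i), DiagramSystem.ofVar i a = f a.1 := fun i a =>
    DiagramSystem.ofVar_map (Λ := Λ) (i := ({a.1}, ∅)) (j := i)
      ⟨Finset.singleton_subset_iff.2 a.2, Finset.empty_subset _⟩ ⟨a.1, Finset.mem_singleton_self _⟩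
  refine ⟨equivOfBijective (homOfFunMap f fun {n} F x => ?_) ⟨fun a b hab => ?_, fun z => ?_⟩⟩
  · classical
    -- A stage that contains the arguments and the value and records this one application.
    let i : Λ.I := (insert (funMap F x) (Finset.univ.image x), {⟨n, F, x⟩})
    let a : Fin n → Λ.X i := fun k => ⟨x k, by simp [i]⟩
    let b : Λ.X i := ⟨funMap F x, by simp [i]⟩
    have hfact : ⟨n, F, a, b⟩ ∈ (Λ.φ i).facts := ⟨Finset.mem_singleton_self _, rfl⟩
    have := DiagramSystem.ofVar_funMap hfact
    simp only [hf] at this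
    exact this.symm
  · classical
    let i : Λ.I := ({a, b}, ∅)
    have ha := hf i ⟨a, Finset.mem_insert_self _ _⟩
    have hb := hf i ⟨b, Finset.mem_insert_of_mem (Finset.mem_singleton_self _)⟩
    exact congrArg Subtype.val (DiagramSystem.ofVar_injective i ((ha.trans hab).trans hb.symm))
  · obtain ⟨i, a, ha⟩ := DiagramSystem.exists_rep fun _ : Fin 1 => z
    exact ⟨(a 0).1, ((ha 0).trans (hf i (a 0))).symm⟩

theorem IsDiscriminatedBy.isLimitAlgebra {A B : Type w} [L.Structure A] [L.Structure B]
    (h : IsDiscriminatedBy L A B) : IsLimitAlgebra L A B := by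
  refine ⟨finiteDiagramSystem B, fun i => ?_, nonempty_equiv_limit_finiteDiagramSystem B⟩
  obtain ⟨f, hf⟩ := h i.1
  refine ⟨fun a => f a.1, fun a b hab heq => hab (Subtype.ext (hf a.2 b.2 heq)),
    fun n F a b hfact => ?_⟩
  have hb : funMap F (fun k => (a k).1) = b.1 := hfact.2
  change _ = f b.1
  rw [← hb, f.map_fun]
  rfl

end Discrimination

/-! ### Decomposition into discriminated pieces -/

section Decomposition

variable {L : FirstOrder.Language.{u, v}} {A C : Type w} [L.Structure A] [L.Structure C]

/-- The set of homomorphisms to `A` that identify all pairs in `S`. -/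
def homZeroSet (L : FirstOrder.Language.{u, v}) (A : Type w) {C : Type w} [L.Structure A]
    [L.Structure C] (S : Set (C × C)) : Set (C →[L] A) :=
  {h | ∀ e ∈ S, h e.1 = h e.2}

/-- The congruence of all pairs identified by each homomorphism in `Y`. -/
def homRadical (Y : Set (C →[L] A)) : Congruence L C where
  r c d := ∀ h ∈ Y, h c = h d
  iseqv := ⟨fun _ _ _ => rfl, fun hc h hh => (hc h hh).symm,
    fun hc hc' h hh => (hc h hh).trans (hc' h hh)⟩
  map_fun f x y hxy h hh := by
    rw [h.map_fun, h.map_fun]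
    exact congrArg (funMap f) (funext fun i => hxy i h hh)

/-- A homomorphism `h` is determined by the point `h ∘ c` for generators `c`, and pairs in `C` lift
to equations between terms, so the statement reduces to systems over `A`. -/
theorem IsEquationallyNoetherian.exists_finite_homZeroSet_eq [L.IsAlgebraic] [Nonempty C]
    (hA : IsEquationallyNoetherian L A) (hC : FirstOrder.Language.Structure.FG L C)
    (S : Set (C × C)) :
    ∃ S₀ ⊆ S, S₀.Finite ∧ homZeroSet L A S₀ = homZeroSet L A S := by
  obtain ⟨n, c, hn, hc⟩ := exists_realize_surjective hC
  let ev : Equation L n → C × C := fun e => (e.1.realize c, e.2.realize c)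
  obtain ⟨R, hR, hfin, heq⟩ := hA n hn (ev ⁻¹' S)
  refine ⟨ev '' R, Set.image_subset_iff.2 hR, hfin.image _, Set.Subset.antisymm ?_ ?_⟩
  · rintro h hh ⟨x, y⟩ hxy
    obtain ⟨t, rfl⟩ := hc x
    obtain ⟨s, rfl⟩ := hc y
    have hmem : h ∘ c ∈ zeroSet A R := fun e he => by
      rw [HomClass.realize_term, HomClass.realize_term]
      exact hh _ ⟨e, he, rfl⟩
    rw [← heq] at hmem
    have := hmem (t, s) hxy
    rwa [HomClass.realize_term, HomClass.realize_term] at this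
  · exact fun h hh e he => hh e (Set.image_subset_iff.2 hR he)

/-- Descending chain condition for sets of homomorphisms defined by equations. -/
theorem IsEquationallyNoetherian.wellFounded_homZeroSet [L.IsAlgebraic] [Nonempty C]
    (hA : IsEquationallyNoetherian L A) (hC : FirstOrder.Language.Structure.FG L C) :
    WellFounded fun S R : Set (C × C) => homZeroSet L A S ⊂ homZeroSet L A R := by
  rw [wellFounded_iff_isEmpty_descending_chain]
  refine ⟨fun ⟨f, hf⟩ => ?_⟩
  have hanti : Antitone fun n => homZeroSet L A (f n) := antitone_nat_of_succ_le fun n => (hf n).1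
  obtain ⟨S₀, hS₀, hfin, heq⟩ := hA.exists_finite_homZeroSet_eq hC (⋃ n, f n)
  have : ∃ N, S₀ ⊆ ⋃ n ∈ Set.Iic N, f n := by
    -- Each of the finitely many equations of `S₀` occurs in some `f n`; the zero set of `f N` then
    -- satisfies all of `S₀`, hence every `f n`, so the chain stops at `N`.
    choose! k hk using fun e (he : e ∈ S₀) => Set.mem_iUnion.1 (hS₀ he)
    obtain ⟨N, hN⟩ := (hfin.image k).bddAbove
    exact ⟨N, fun e he => Set.mem_iUnion₂.2 ⟨k e, hN ⟨e, he, rfl⟩, hk e he⟩⟩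
  obtain ⟨N, hN⟩ := this
  refine (hf N).2 fun h hh => ?_
  have hmem : h ∈ homZeroSet L A S₀ := fun e he => by
    obtain ⟨n, hn, hen⟩ := Set.mem_iUnion₂.1 (hN he)
    exact hanti hn hh e hen
  rw [heq] at hmem
  exact fun e he => hmem e (Set.mem_iUnion.2 ⟨_, he⟩)

/-- If finitely many distinct elements of `C / rad Y` can always be kept apart by a
homomorphism in `Y`, then `C / rad Y` is discriminated by `A`. -/
theorem isDiscriminatedBy_quot_homRadical [L.IsAlgebraic] {Y : Set (C →[L] A)}
    (h : ∀ P : Set (C × C), P.Finite → (∀ e ∈ P, ¬ (homRadical Y).r e.1 e.2) →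
      ∃ f ∈ Y, ∀ e ∈ P, f e.1 ≠ f e.2) :
    IsDiscriminatedBy L A (homRadical Y).Quot := by
  intro S
  choose r hr using (homRadical Y).mkHom_surjective
  -- Separating these finitely many representatives means being injective on `S` after factoring
  -- through the quotient.
  let P : Set (C × C) := (fun q => (r q.1, r q.2)) ''
    {q : (homRadical Y).Quot × (homRadical Y).Quot | q.1 ∈ S ∧ q.2 ∈ S ∧ q.1 ≠ q.2}
  obtain ⟨f, hf, hfP⟩ := h P (((S ×ˢ S).finite_toSet.subset fun q hq => by
      simpa using ⟨hq.1, hq.2.1⟩).image _) (by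
    rintro _ ⟨q, hq, rfl⟩
    rw [← Congruence.mkHom_eq_iff, hr, hr]
    exact hq.2.2)
  obtain ⟨g, hg⟩ := (homRadical Y).exists_lift f fun x y hxy => hxy f hf
  refine ⟨g, fun p hp q hq hpq => ?_⟩
  by_contra hne
  refine hfP _ ⟨(p, q), ⟨hp, hq, hne⟩, rfl⟩ ?_
  rw [← hg, ← hg, hr, hr, hpq]

/-- Every set of homomorphisms defined by equations is a finite union of sets whose coordinate
algebras are discriminated by `A`. -/
theorem IsEquationallyNoetherian.exists_decomposition [L.IsAlgebraic] [Nonempty C]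
    (hA : IsEquationallyNoetherian L A) (hC : FirstOrder.Language.Structure.FG L C)
    (S : Set (C × C)) :
    ∃ 𝒴 : Set (Set (C →[L] A)), 𝒴.Finite ∧ ⋃₀ 𝒴 = homZeroSet L A S ∧
      ∀ Y ∈ 𝒴, IsDiscriminatedBy L A (homRadical Y).Quot := by
  induction S using (hA.wellFounded_homZeroSet hC).induction with
  | _ S ih =>
  by_cases hS : ∀ P : Set (C × C), P.Finite →
      (∀ e ∈ P, ¬ (homRadical (homZeroSet L A S)).r e.1 e.2) →
      ∃ f ∈ homZeroSet L A S, ∀ e ∈ P, f e.1 ≠ f e.2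
  · refine ⟨{homZeroSet L A S}, Set.finite_singleton _, Set.sUnion_singleton _, ?_⟩
    rintro _ rfl
    exact isDiscriminatedBy_quot_homRadical hS
  -- Every homomorphism in the set now identifies some pair of `P`, so the set is the union of its
  -- subsets cut out by one more equation `e ∈ P`. Each is proper because `e` is outside the
  -- radical. If the set is empty, `P` may be empty, and then the cover is too.
  · push Not at hS
    obtain ⟨P, hfin, hP, hcover⟩ := hS
    have hle : ∀ e, homZeroSet L A (insert e S) ⊆ homZeroSet L A S :=
      fun e h hh d hd => hh d (Set.mem_insert_of_mem _ hd)
    have hlt : ∀ e ∈ P, homZeroSet L A (insert e S) ⊂ homZeroSet L A S := fun e he =>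
      ⟨hle e, fun hsub => hP e he fun h hh => hsub hh e (Set.mem_insert _ _)⟩
    choose! 𝒴 h𝒴fin h𝒴 hdisc using fun e he => ih (insert e S) (hlt e he)
    refine ⟨⋃ e ∈ P, 𝒴 e, hfin.biUnion h𝒴fin, Set.Subset.antisymm ?_ ?_, ?_⟩
    · rintro h ⟨Y, hY, hh⟩
      obtain ⟨e, he, hYe⟩ := Set.mem_iUnion₂.1 hY
      exact hle e (h𝒴 e he ▸ ⟨Y, hYe, hh⟩)
    · intro h hh
      obtain ⟨e, he, heq⟩ := hcover h hh
      have hmem : h ∈ homZeroSet L A (insert e S) := by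
        rintro d (rfl | hd)
        exacts [heq, hh d hd]
      rw [← h𝒴 e he] at hmem
      obtain ⟨Y, hY, hhY⟩ := hmem
      exact ⟨Y, Set.mem_iUnion₂.2 ⟨e, he, hY⟩, hhY⟩
    · intro Y hY
      obtain ⟨e, he, hYe⟩ := Set.mem_iUnion₂.1 hY
      exact hdisc e he Y hYe

/-- The empty system cuts out all homomorphisms. One that separates two elements lies in some piece
`Y i`, so their images in `C / rad (Y i)` differ. -/
theorem IsSeparatedBy.isFiniteSubdirectProductOfLimits [L.IsAlgebraic] [Nonempty C]
    (hA : IsEquationallyNoetherian L A) (hC : FirstOrder.Language.Structure.FG L C)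
    (h : IsSeparatedBy L A C) : IsFiniteSubdirectProductOfLimits L A C := by
  obtain ⟨𝒴, hfin, hcover, hdisc⟩ := hA.exists_decomposition hC (∅ : Set (C × C))
  obtain ⟨k, Y, -, hY⟩ := hfin.fin_param
  refine ⟨k, fun i => (homRadical (Y i)).Quot, fun i => inferInstance,
    fun i => (hdisc _ (hY ▸ ⟨i, rfl⟩)).isLimitAlgebra,
    embeddingOfInjective (homOfFunMap (fun c i => (homRadical (Y i)).mkHom c) fun F x =>
      funext fun i => (homRadical (Y i)).mkHom.map_fun F x) fun c d hcd => ?_,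
    fun i => (homRadical (Y i)).mkHom_surjective⟩
  by_contra hne
  obtain ⟨f, hf⟩ := h c d hne
  have hmem : f ∈ ⋃₀ 𝒴 := by
    rw [hcover]
    exact fun _ he => he.elim
  obtain ⟨_, hZ, hfZ⟩ := hmem
  rw [← hY] at hZ
  obtain ⟨i, rfl⟩ := hZ
  exact hf ((homRadical (Y i)).mkHom_eq_iff.1 (congrFun hcd i) f hfZ)

end Decomposition

end UAG

theorem theoremC (L : FirstOrder.Language.{u, v}) [L.IsAlgebraic]
    (A : Type w) [L.Structure A] [Nonempty A] (hA : UAG.IsEquationallyNoetherian L A)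
    (C : Type w) [L.Structure C] [Nonempty C] (hC : FirstOrder.Language.Structure.FG L C) :
    List.TFAE
      [UAG.InQvar L A C,
       UAG.quasiTheory L A ⊆ UAG.quasiTheory L C,
       UAG.InPvar L A C,
       UAG.EmbedsInPower L A C,
       UAG.IsSeparatedBy L A C,
       UAG.IsFiniteSubdirectProductOfLimits L A C,
       UAG.IsDefinedByCompleteAtomicType L (UAG.quasiTheory L A) C,
       UAG.IsCoordinateAlgebra L A C] := by
  tfae_have 1 ↔ 2 := UAG.quasiTheory_subset_iff.symm
  tfae_have 1 → 7 := fun h => h.isDefinedByCompleteAtomicType hC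
  tfae_have 7 → 1 := fun h => h.inQvar
  tfae_have 1 → 8 := fun h => h.isCoordinateAlgebra hA hC
  tfae_have 8 → 5 := fun h => h.isSeparatedBy
  tfae_have 5 → 4 := fun h => h.embedsInPower
  tfae_have 4 → 3 := fun h => h.inPvar
  tfae_have 3 → 5 := fun h => h.isSeparatedBy
  tfae_have 5 → 6 := fun h => h.isFiniteSubdirectProductOfLimits hA hC
  tfae_have 6 → 1 := fun h => h.inQvar
  tfae_finish
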